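/- Write $\chi(G)$ for the group of homomorphisms $G\to\{1,-1\}$. A space of orderings is a pair $(X,G)$ where $X$ is a nonempty set and $G$ is a subgroup of $\{1,-1\}^X$ which contains the constant function $-1$ and separates points of $X$, such that, identifying $x\in X$ with the character $a\mapsto a(x)$ of $G$ and putting $D(a,b)=\{c\in G:\forall x\in X\ (c(x)=a(x)\text{ or }c(x)=b(x))\}$ for $a,b\in G$, (1) every $\sigma\in\chi(G)$ with $\sigma(-1)=-1$ and $D(a,b)\subseteq\ker\sigma$ for all $a,b\in\ker\sigma$ lies in $X$; and (2) for all $a_1,a_2,a_3,b,c\in G$ with $b\in D(a_1,c)$ and $c\in D(a_2,a_3)$ there is $d\in D(a_1,a_2)$ with $b\in D(d,a_3)$. Let $(X,G)$ be a space of orderings, let $G_0$ be a subgroup of index two in $G$ with $-1\in G_0$, and let $\gamma\in\chi(G)$ be the unique character of $G$ with $\ker\gamma=G_0$. Let $X_0=X|_{G_0}$ be the set of restrictions to $G_0$ of the characters in $X$, and regard $G_0$ as a group of functions $X_0\to\{1,-1\}$ by evaluation. If $(X_0,G_0)$ is a space of orderings, then there are $\sigma_1,\sigma_2,\sigma_3,\sigma_4\in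 X$, not necessarily distinct, such that $\gamma=\sigma_1\sigma_2\sigma_3\sigma_4$ in $\chi(G)$; that is, $\gamma\in X^4$. -/

import Mathlib

universe u

namespace SpaceOfOrderings

/-- The value set `D(a, b)`: all `c` in `G` with `c x = a x` or `c x = b x` at every `x : X`. -/
def valueSet {X : Type u} (G : Subgroup (X → ℤˣ)) (a b : G) : Set G :=
  {c | ∀ x : X, (c : X → ℤˣ) x = (a : X → ℤˣ) x ∨ (c : X → ℤˣ) x = (b : X → ℤˣ) x}

/-- The natural map from `X` to the character group `χ(G)`, sending `x` to `a ↦ a x`. -/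
def evalChar {X : Type u} (G : Subgroup (X → ℤˣ)) (x : X) : G →* ℤˣ :=
  (Pi.evalMonoidHom (fun _ : X => ℤˣ) x).comp G.subtype

/-- `(X, G)` is a space of orderings. -/
structure IsSpaceOfOrderings {X : Type u} (G : Subgroup (X → ℤˣ)) : Prop where
  nonempty : Nonempty X
  neg_one_mem : (-1 : X → ℤˣ) ∈ G
  separates : ∀ x y : X, (∀ a ∈ G, a x = a y) → x = y
  mem_range_evalChar : ∀ χ : G →* ℤˣ, χ ⟨-1, neg_one_mem⟩ = -1 →
    (∀ a b : G, a ∈ χ.ker → b ∈ χ.ker → valueSet G a b ⊆ (χ.ker : Set G)) →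
    χ ∈ Set.range (evalChar G)
  assoc : ∀ a₁ a₂ a₃ b c : G, ∃ d : G,
    b ∈ valueSet G a₁ c ∧ c ∈ valueSet G a₂ a₃ →
    b ∈ valueSet G d a₃ ∧ d ∈ valueSet G a₁ a₂

/-- The set `X₀ = X|_{G₀}` of restrictions to `G₀` of the characters coming from `X`. -/
def restrictedChars {X : Type u} (G : Subgroup (X → ℤˣ)) (G₀ : Subgroup G) :
    Set (G₀ →* ℤˣ) :=
  Set.range fun x : X => (evalChar G x).comp G₀.subtype

/-- The natural map from `G₀` to the group of sign functions on `X₀`, sending `g` to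
`α ↦ α g`. -/
def quotientMap {X : Type u} (G : Subgroup (X → ℤˣ)) (G₀ : Subgroup G) :
    G₀ →* (restrictedChars G G₀ → ℤˣ) where
  toFun g α := (α : G₀ →* ℤˣ) g
  map_one' := funext fun α => map_one (α : G₀ →* ℤˣ)
  map_mul' g h := funext fun α => map_mul (α : G₀ →* ℤˣ) g h

/-- `G₀` is identified with its image under `quotientMap`, i.e. nothing is collapsed. -/
theorem quotientMap_injective {X : Type u} (G : Subgroup (X → ℤˣ)) (G₀ : Subgroup G) :
    Function.Injective (quotientMap G G₀) := by
  intro g h hgh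
  apply Subtype.ext
  apply Subtype.ext
  funext x
  exact congrFun hgh ⟨(evalChar G x).comp G₀.subtype, x, rfl⟩

/-- The quotient structure `(X₀, G₀)`: the group `G₀` as a group of sign functions on `X₀`. -/
def quotientStructure {X : Type u} (G : Subgroup (X → ℤˣ)) (G₀ : Subgroup G) :
    Subgroup (restrictedChars G G₀ → ℤˣ) :=
  (quotientMap G G₀).range

/-- The set `X ^ k` of products of `k` (not necessarily distinct) elements of `X` in `χ(G)`. -/
def charProducts {X : Type u} (G : Subgroup (X → ℤˣ)) (k : ℕ) : Set (G →* ℤˣ) :=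
  {χ | ∃ σ : Fin k → X, χ = ∏ i, evalChar G (σ i)}

end SpaceOfOrderings

namespace SpaceOfOrderings

variable {X : Type u} {G : Subgroup (X → ℤˣ)}

/-! Take a saturated subgroup `T`, maximal among those inside `ker γ`, and let `Y ⊆ X` be its zero
set. Write `a ≤ b` if `b = 1` wherever `a = 1` on `Y`. By maximality, every `b ∉ T` lies below some
`c` with `γ c = -1` (`hfull`). Associativity in the quotient then makes `≤` trivial on `ker γ`
modulo `T` (`mul_mem_of_chain`, `mem_of_le`), so `Y` restricts to a fan: on `ker γ`, any product of
three points of `Y` is a point `w` of `X` (`exists_eq_mul_mul`). Hence `x y z w` is trivial on `ker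
γ`, and a suitable choice of `x, y, z` makes it `-1` at one element outside, so it equals `γ`. -/

theorem mul_self_eq_one (a : G) : a * a = 1 :=
  Subtype.ext (funext fun _ => Int.units_mul_self _)

theorem inv_eq_self (a : G) : a⁻¹ = a :=
  inv_eq_of_mul_eq_one_left (mul_self_eq_one a)

theorem mul_mem_valueSet {a b c : G} (g : G) (h : c ∈ valueSet G a b) :
    g * c ∈ valueSet G (g * a) (g * b) := fun x =>
  (h x).imp (fun h => congrArg (g.1 x * ·) h) (fun h => congrArg (g.1 x * ·) h)

theorem mem_valueSet_comm {a b c : G} : c ∈ valueSet G a b ↔ c ∈ valueSet G b a :=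
  forall_congr' fun _ => or_comm

theorem left_mem_valueSet (a b : G) : a ∈ valueSet G a b := fun _ => Or.inl rfl

theorem right_mem_valueSet (a b : G) : b ∈ valueSet G a b := fun _ => Or.inr rfl

/-- The four-fold exchange property: the value sets of quaternary forms do not depend on the
grouping of the entries. -/
theorem IsSpaceOfOrderings.exchange (hG : IsSpaceOfOrderings G) {e a b s x s' y : G}
    (he : e ∈ valueSet G a b) (ha : a ∈ valueSet G s x) (hb : b ∈ valueSet G s' y) :
    ∃ u ∈ valueSet G s s', ∃ v ∈ valueSet G x y, e ∈ valueSet G u v := by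
  obtain ⟨d, hd⟩ := hG.assoc b s x e a
  obtain ⟨h₁, h₂⟩ := hd ⟨mem_valueSet_comm.1 he, ha⟩
  obtain ⟨d', hd'⟩ := hG.assoc s s' y d b
  obtain ⟨h₃, h₄⟩ := hd' ⟨mem_valueSet_comm.1 h₂, hb⟩
  obtain ⟨d'', hd''⟩ := hG.assoc x y d' e d
  obtain ⟨h₅, h₆⟩ := hd'' ⟨mem_valueSet_comm.1 h₁, mem_valueSet_comm.1 h₃⟩
  exact ⟨d', h₄, d'', h₆, mem_valueSet_comm.1 h₅⟩

/-- A subgroup is saturated if it is closed under value sets. -/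
def IsSaturated (T : Subgroup G) : Prop :=
  ∀ s ∈ T, ∀ t ∈ T, valueSet G s t ⊆ (T : Set G)

/-- The saturated subgroup generated by a saturated subgroup `T` and an element `b`. -/
def adjoin (hG : IsSpaceOfOrderings G) (T : Subgroup G) (hT : IsSaturated T) (b : G) :
    Subgroup G where
  carrier := {c | ∃ s ∈ T, ∃ t ∈ T, c ∈ valueSet G s (t * b)}
  one_mem' := ⟨1, one_mem T, 1, one_mem T, left_mem_valueSet _ _⟩
  inv_mem' := by
    intro c hc
    rwa [inv_eq_self]
  mul_mem' := by
    rintro c c' ⟨s, hs, t, ht, hc⟩ ⟨s', hs', t', ht', hc'⟩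
    -- The product form `⟨s, tb⟩ ⊗ ⟨s', t'b⟩` represents `c * c'`; as `b² = 1`, its entries regroup
    -- as `ss', tt'` and `b` times `st', ts'`.
    have h₁ := mul_mem_valueSet c' hc
    have h₂ := mul_mem_valueSet s hc'
    have h₃ := mem_valueSet_comm.1 (mul_mem_valueSet (t * b) hc')
    rw [mul_comm s c'] at h₂
    rw [mul_comm (t * b) c'] at h₃
    obtain ⟨u, hu, v, hv, huv⟩ := hG.exchange h₁ h₂ h₃
    have e₁ : t * b * (t' * b) = t * t' := by
      rw [mul_mul_mul_comm, mul_self_eq_one, mul_one]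
    rw [e₁] at hu
    have hv' := mul_mem_valueSet b hv
    have e₂ : b * (s * (t' * b)) = s * t' := by
      rw [← mul_assoc s, mul_comm, mul_assoc, mul_self_eq_one, mul_one]
    have e₃ : b * (t * b * s') = t * s' := by
      rw [mul_right_comm, mul_comm, mul_assoc, mul_self_eq_one, mul_one]
    rw [e₂, e₃] at hv'
    refine ⟨u, hT _ (mul_mem hs hs') _ (mul_mem ht ht') hu, b * v,
      hT _ (mul_mem hs ht') _ (mul_mem ht hs') hv', ?_⟩
    rw [mul_comm b v, mul_assoc, mul_self_eq_one, mul_one, mul_comm c c']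
    exact huv

theorem isSaturated_adjoin (hG : IsSpaceOfOrderings G) {T : Subgroup G} (hT : IsSaturated T)
    (b : G) : IsSaturated (adjoin hG T hT b) := by
  rintro c ⟨s, hs, t, ht, hc⟩ c' ⟨s', hs', t', ht', hc'⟩ e he
  obtain ⟨u, hu, v, hv, huv⟩ := hG.exchange he hc hc'
  have hv' := mul_mem_valueSet b hv
  rw [mul_comm b (t * b), mul_comm b (t' * b), mul_assoc, mul_assoc, mul_self_eq_one, mul_one,
    mul_one] at hv'
  refine ⟨u, hT _ hs _ hs' hu, b * v, hT _ ht _ ht' hv', ?_⟩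
  rw [mul_comm b v, mul_assoc, mul_self_eq_one, mul_one]
  exact huv

theorem le_adjoin (hG : IsSpaceOfOrderings G) {T : Subgroup G} (hT : IsSaturated T) (b : G) :
    T ≤ adjoin hG T hT b := fun t ht => ⟨t, ht, 1, one_mem T, left_mem_valueSet _ _⟩

theorem self_mem_adjoin (hG : IsSpaceOfOrderings G) {T : Subgroup G} (hT : IsSaturated T) (b : G) :
    b ∈ adjoin hG T hT b :=
  ⟨1, one_mem T, 1, one_mem T, by simpa using right_mem_valueSet 1 b⟩

/-- Zorn's lemma for saturated subgroups avoiding a given set. -/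
theorem exists_maximal_isSaturated (S : Set G) (T : Subgroup G) (hT : IsSaturated T)
    (hTS : Disjoint (T : Set G) S) :
    ∃ P : Subgroup G, T ≤ P ∧
      Maximal (fun P : Subgroup G => IsSaturated P ∧ Disjoint (P : Set G) S) P := by
  refine zorn_le_nonempty₀ {P : Subgroup G | IsSaturated P ∧ Disjoint (P : Set G) S} ?_ T ⟨hT, hTS⟩
  intro c hc hchain Q hQ
  have hdir : DirectedOn (· ≤ ·) c := hchain.directedOn
  have hmem : ∀ {a : G}, a ∈ sSup c ↔ ∃ P ∈ c, a ∈ P := fun {a} =>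
    Subgroup.mem_sSup_of_directedOn ⟨Q, hQ⟩ hdir
  refine ⟨sSup c, ⟨?_, ?_⟩, fun P hP => le_sSup hP⟩
  · intro s hs t ht a ha
    obtain ⟨P, hP, hsP⟩ := hmem.1 hs
    obtain ⟨P', hP', htP'⟩ := hmem.1 ht
    obtain ⟨R, hR, h₁, h₂⟩ := hdir P hP P' hP'
    exact hmem.2 ⟨R, hR, (hc hR).1 s (h₁ hsP) t (h₂ htP') ha⟩
  · rw [Set.disjoint_left]
    intro a ha
    obtain ⟨P, hP, haP⟩ := hmem.1 ha
    exact Set.disjoint_left.1 (hc hP).2 haP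

theorem units_eq_neg_one_of_ne_one {a : ℤˣ} (h : a ≠ 1) : a = -1 :=
  (Int.units_eq_one_or a).resolve_left h

/-- The constant function `-1`, as an element of `G`. -/
def negOne (hG : IsSpaceOfOrderings G) : G := ⟨-1, hG.neg_one_mem⟩

theorem negOne_apply (hG : IsSpaceOfOrderings G) (x : X) : (negOne hG : G).1 x = -1 := rfl

/-- A saturated subgroup and an element outside it are separated by a point of `X`. -/
theorem IsSpaceOfOrderings.exists_separating (hG : IsSpaceOfOrderings G) {T : Subgroup G}
    (hT : IsSaturated T) {c : G} (hc : c ∉ T) :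
    ∃ x : X, (∀ t ∈ T, t.1 x = 1) ∧ c.1 x = -1 := by
  obtain ⟨P, hTP, hP⟩ := exists_maximal_isSaturated {c} T hT (by simpa using hc)
  have hcP : c ∉ P := by simpa using hP.prop.2
  have hsat := hP.prop.1
  -- Maximality puts `c` in every proper extension of `P`. This forces `-c ∈ P`, then `P ∪ -P = G`,
  -- so `P` is the kernel of a character.
  have key : ∀ a, a ∉ P → c ∈ adjoin hG P hsat a := by
    intro a ha
    by_contra hca
    exact ha (hP.le_of_ge ⟨isSaturated_adjoin hG hsat a, by simpa using hca⟩
      (le_adjoin hG hsat a) (self_mem_adjoin hG hsat a))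
  have hnc : negOne hG * c ∈ P := by
    by_contra h
    obtain ⟨s, hs, t, ht, hst⟩ := key _ h
    refine hcP ?_
    have : s * c ∈ valueSet G 1 t := by
      intro x
      have := hst x
      simp only [Subgroup.coe_mul, Pi.mul_apply, negOne_apply, Subgroup.coe_one,
        Pi.one_apply] at this ⊢
      rcases Int.units_eq_one_or (s.1 x) with h₁ | h₁ <;>
      rcases Int.units_eq_one_or (t.1 x) with h₂ | h₂ <;>
      rcases Int.units_eq_one_or (c.1 x) with h₃ | h₃ <;>
      simp_all
    exact (Subgroup.mul_mem_cancel_left P hs).1 (hsat _ (one_mem P) _ ht this)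
  have hneg : ∀ a, a ∉ P → negOne hG * a ∈ P := by
    intro a ha
    obtain ⟨s, hs, t, ht, hst⟩ := key _ ha
    have : t * (negOne hG * a) ∈ valueSet G s (negOne hG * c) := by
      intro x
      have := hst x
      simp only [Subgroup.coe_mul, Pi.mul_apply, negOne_apply] at this ⊢
      rcases Int.units_eq_one_or (s.1 x) with h₁ | h₁ <;>
      rcases Int.units_eq_one_or (t.1 x) with h₂ | h₂ <;>
      rcases Int.units_eq_one_or (c.1 x) with h₃ | h₃ <;>
      rcases Int.units_eq_one_or (a.1 x) with h₄ | h₄ <;>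
      simp_all
    exact (Subgroup.mul_mem_cancel_left P ht).1 (hsat _ hs _ hnc this)
  have hneg1 : negOne hG ∉ P := fun h => hcP ((Subgroup.mul_mem_cancel_left P h).1 hnc)
  classical
  let χ : G →* ℤˣ :=
    { toFun := fun a => if a ∈ P then 1 else -1
      map_one' := if_pos (one_mem P)
      map_mul' := by
        intro a b
        by_cases ha : a ∈ P
        · simp [ha, Subgroup.mul_mem_cancel_left P ha]
        · by_cases hb : b ∈ P
          · simp [ha, hb, Subgroup.mul_mem_cancel_right P hb]
          · have : a * b ∈ P := by
              have := mul_mem (hneg a ha) (hneg b hb)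
              rwa [mul_mul_mul_comm, mul_self_eq_one, one_mul] at this
            simp [ha, hb, this] }
  have hχ : ∀ a, a ∈ χ.ker ↔ a ∈ P := by
    intro a
    change (if a ∈ P then (1 : ℤˣ) else -1) = 1 ↔ _
    split_ifs with h <;> simp [h]
  obtain ⟨x, hx⟩ := hG.mem_range_evalChar χ (if_neg hneg1) (by
    intro a b ha hb d hd
    exact (hχ d).2 (hsat a ((hχ a).1 ha) b ((hχ b).1 hb) hd))
  refine ⟨x, fun t ht => ?_, ?_⟩
  · exact (DFunLike.congr_fun hx t).trans (if_pos (hTP ht))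
  · exact (DFunLike.congr_fun hx c).trans (if_neg hcP)

/-- Value sets relative to the zero set of a saturated subgroup `T` are represented globally, up
to elements of `T`. -/
theorem IsSpaceOfOrderings.exists_mem_valueSet (hG : IsSpaceOfOrderings G) {T : Subgroup G}
    (hT : IsSaturated T) {a b c : G}
    (h : ∀ x, (∀ t ∈ T, t.1 x = 1) → c.1 x = a.1 x ∨ c.1 x = b.1 x) :
    ∃ s ∈ T, ∃ t ∈ T, c ∈ valueSet G (s * a) (t * b) := by
  -- After translation by `a`, a point separating `c * a` from this subgroup would lie in the zero
  -- set of `T` and have `b = a ≠ c`.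
  by_cases hc : c * a ∈ adjoin hG T hT (b * a)
  · obtain ⟨s, hs, t, ht, hst⟩ := hc
    refine ⟨s, hs, t, ht, ?_⟩
    have := mul_mem_valueSet a hst
    rwa [mul_left_comm a c, mul_self_eq_one, mul_one, mul_comm a s, mul_left_comm a t,
      mul_left_comm a b, mul_self_eq_one, mul_one] at this
  · exfalso
    obtain ⟨x, hx, hcx⟩ := hG.exists_separating (isSaturated_adjoin hG hT _) hc
    have h₁ := hx _ (self_mem_adjoin hG hT _)
    have h₂ := h x fun t ht => hx t (le_adjoin hG hT _ ht)
    simp only [Subgroup.coe_mul, Pi.mul_apply] at h₁ hcx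
    rcases Int.units_eq_one_or (a.1 x) with h₃ | h₃ <;> simp_all

/-! ### Transfer of the quotient axioms to `G` -/

/-- The associativity axiom of the quotient structure, in terms of elements of `G`. -/
theorem exists_of_quotientStructure {G₀ : Subgroup G}
    (hquot : IsSpaceOfOrderings (quotientStructure G G₀)) {a₁ a₂ a₃ b c : G}
    (h₁ : a₁ ∈ G₀) (h₂ : a₂ ∈ G₀) (h₃ : a₃ ∈ G₀) (hb : b ∈ G₀) (hc : c ∈ G₀)
    (hbc : b ∈ valueSet G a₁ c) (hca : c ∈ valueSet G a₂ a₃) :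
    ∃ d ∈ G₀, b ∈ valueSet G d a₃ ∧ d ∈ valueSet G a₁ a₂ := by
  let q : G₀ → quotientStructure G G₀ := (quotientMap G G₀).rangeRestrict
  have hq : ∀ u v w : G₀,
      q w ∈ valueSet (quotientStructure G G₀) (q u) (q v) ↔ w.1 ∈ valueSet G u.1 v.1 := by
    intro u v w
    constructor
    · intro h x
      exact h ⟨(evalChar G x).comp G₀.subtype, x, rfl⟩
    · rintro h ⟨_, x, rfl⟩
      exact h x
  obtain ⟨d, hd⟩ := hquot.assoc (q ⟨a₁, h₁⟩) (q ⟨a₂, h₂⟩) (q ⟨a₃, h₃⟩) (q ⟨b, hb⟩) (q ⟨c, hc⟩)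
  obtain ⟨⟨d, hdG⟩, rfl⟩ := (quotientMap G G₀).rangeRestrict_surjective d
  obtain ⟨h₄, h₅⟩ := hd ⟨(hq _ _ ⟨b, hb⟩).2 hbc, (hq _ _ ⟨c, hc⟩).2 hca⟩
  exact ⟨d, hdG, (hq _ ⟨a₃, h₃⟩ ⟨b, hb⟩).1 h₄, (hq ⟨a₁, h₁⟩ ⟨a₂, h₂⟩ ⟨d, hdG⟩).1 h₅⟩

/-- The first axiom of the quotient structure, in terms of elements of `G`. -/
theorem exists_eq_of_quotientStructure {G₀ : Subgroup G} (hG : IsSpaceOfOrderings G)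
    (hquot : IsSpaceOfOrderings (quotientStructure G G₀)) (hneg : negOne hG ∈ G₀) (χ : G →* ℤˣ)
    (hχ : χ (negOne hG) = -1)
    (h : ∀ a ∈ G₀, ∀ b ∈ G₀, ∀ c ∈ G₀, χ a = 1 → χ b = 1 → c ∈ valueSet G a b → χ c = 1) :
    ∃ x : X, ∀ g ∈ G₀, χ g = g.1 x := by
  let e : G₀ ≃* quotientStructure G G₀ := MonoidHom.ofInjective (quotientMap_injective G G₀)
  let σ : quotientStructure G G₀ →* ℤˣ := (χ.comp G₀.subtype).comp e.symm.toMonoidHom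
  have hσ : ∀ g, σ (e g) = χ g.1 := fun g => by
    change χ (e.symm (e g)).1 = _
    rw [e.symm_apply_apply]
  obtain ⟨⟨_, x, rfl⟩, hx⟩ := hquot.mem_range_evalChar σ (by
    have : (⟨-1, hquot.neg_one_mem⟩ : quotientStructure G G₀) = e ⟨negOne hG, hneg⟩ := by
      apply Subtype.ext
      funext α
      obtain ⟨_, x, rfl⟩ := α
      rfl
    rw [this, hσ]
    exact hχ) (by
    intro a b ha hb c hc
    obtain ⟨a, rfl⟩ := e.surjective a
    obtain ⟨b, rfl⟩ := e.surjective b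
    obtain ⟨c, rfl⟩ := e.surjective c
    rw [MonoidHom.mem_ker, hσ] at ha hb
    rw [SetLike.mem_coe, MonoidHom.mem_ker, hσ]
    refine h a a.2 b b.2 c c.2 ha hb fun x => ?_
    exact hc ⟨(evalChar G x).comp G₀.subtype, x, rfl⟩)
  refine ⟨x, fun g hg => ?_⟩
  rw [← hσ ⟨g, hg⟩, ← hx]
  rfl

/-! ### The order modulo `T` and the fan on `ker γ` -/

theorem signs_left : ∀ e t r s u : ℤˣ, (e = 1 → t = 1) → (t = 1 → r = 1) → (r = 1 → s = 1) →
    (t * r = 1 → u = 1) → -1 * (e * s) = 1 ∨ -1 * (e * s) = -1 * (r * s * u) := by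
  decide

theorem signs_right : ∀ e t r s u : ℤˣ, (e = 1 → t = 1) → (t = 1 → r = 1) → (r = 1 → s = 1) →
    (t * r = 1 → u = 1) → -1 * (r * s * u) = -1 * t ∨ -1 * (r * s * u) = e * r * s := by
  decide

set_option synthInstance.maxSize 1000 in
-- Forces the associativity witness `d` to equal `-e` on the zero set of `T`, although `γ d = 1` and
-- `γ (-e) = -1`.
theorem signs_unique : ∀ e t r s d : ℤˣ, (e = 1 → t = 1) → (t = 1 → r = 1) → (r = 1 → s = 1) →
    (-1 * (e * s) = d ∨ -1 * (e * s) = e * r * s) → (d = 1 ∨ d = -1 * t) →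
    d * (-1 * e) = 1 := by
  decide

theorem signs_mul_eq_neg_one : ∀ tx ty tz cx cy cz cw : ℤˣ, (tx = 1 → cx = 1) →
    (ty = 1 → cy = 1) → (tx * ty * tz = 1 → cw = 1) → -1 * tx = -1 → cy = -1 →
    (tz = 1 → cz = 1) → cz * tz = -1 → cx * cy * cz * cw = -1 := by
  decide

/-- If `T` is maximal among the saturated subgroups contained in `ker γ`, then a chain
`e ≤ t ≤ r ≤ s` on the zero set of `T` with values `-1, 1, 1, -1` under `γ` satisfies
`t = r` modulo `T`. -/
theorem mul_mem_of_chain (hG : IsSpaceOfOrderings G) {γ : G →* ℤˣ}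
    (hquot : IsSpaceOfOrderings (quotientStructure G γ.ker)) (hneg : γ (negOne hG) = 1)
    {T : Subgroup G} (hT : IsSaturated T) (hTγ : T ≤ γ.ker)
    (hfull : ∀ b ∉ T, ∃ c, γ c = -1 ∧ ∀ x, (∀ t ∈ T, t.1 x = 1) → b.1 x = 1 → c.1 x = 1)
    {e t r s : G} (he : γ e = -1) (ht : γ t = 1) (hr : γ r = 1) (hs : γ s = -1)
    (het : ∀ x, (∀ t ∈ T, t.1 x = 1) → e.1 x = 1 → t.1 x = 1)
    (htr : ∀ x, (∀ t ∈ T, t.1 x = 1) → t.1 x = 1 → r.1 x = 1)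
    (hrs : ∀ x, (∀ t ∈ T, t.1 x = 1) → r.1 x = 1 → s.1 x = 1) : t * r ∈ T := by
  by_contra htrT
  obtain ⟨u, hu, htu⟩ := hfull _ htrT
  let n := negOne hG
  -- All entries here lie in `ker γ`, although `e`, `s` and `u` do not: they occur in pairs.
  obtain ⟨v₁, hv₁, v₂, hv₂, h₁⟩ := hG.exists_mem_valueSet hT (a := 1) (b := n * (r * s * u))
    (c := n * (e * s)) fun x hx =>
      signs_left _ _ _ _ _ (het x hx) (htr x hx) (hrs x hx) (htu x hx)
  obtain ⟨v₃, hv₃, v₄, hv₄, h₂⟩ := hG.exists_mem_valueSet hT (a := n * t) (b := e * r * s)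
    (c := n * (r * s * u)) fun x hx =>
      signs_right _ _ _ _ _ (het x hx) (htr x hx) (hrs x hx) (htu x hx)
  have hγT : ∀ v ∈ T, γ v = 1 := fun v hv => hTγ hv
  obtain ⟨d, hd, h₃, h₄⟩ := exists_of_quotientStructure hquot (a₁ := v₁ * 1)
    (a₂ := v₂ * (v₃ * (n * t))) (a₃ := v₂ * (v₄ * (e * r * s))) (b := n * (e * s))
    (c := v₂ * (n * (r * s * u)))
    (by simp [MonoidHom.mem_ker, hγT _ hv₁])
    (by simp [MonoidHom.mem_ker, hγT _ hv₂, hγT _ hv₃, n, hneg, ht])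
    (by simp [MonoidHom.mem_ker, hγT _ hv₂, hγT _ hv₄, he, hr, hs])
    (by simp [MonoidHom.mem_ker, n, hneg, he, hs])
    (by simp [MonoidHom.mem_ker, hγT _ hv₂, n, hneg, hr, hs, hu])
    h₁ (mul_mem_valueSet v₂ h₂)
  have hde : d * (n * e) ∈ T := by
    by_contra hde
    obtain ⟨x, hx, hdx⟩ := hG.exists_separating hT hde
    have k₄ := h₃ x
    have k₅ := h₄ x
    simp only [Subgroup.coe_mul, Pi.mul_apply, one_mul, mul_one,
      hx v₁ hv₁, hx v₂ hv₂, hx v₃ hv₃, hx v₄ hv₄] at hdx k₄ k₅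
    have h₅ : (1 : ℤˣ) = -1 :=
      (signs_unique _ _ _ _ _ (het x hx) (htr x hx) (hrs x hx) k₄ k₅).symm.trans hdx
    exact absurd h₅ (by decide)
  have h₅ := hγT _ hde
  rw [MonoidHom.mem_ker] at hd
  simp [n, hd, hneg, he] at h₅

/-- In the situation of `mul_mem_of_chain`, the order on `γ.ker` given by the zero set of `T` is
trivial. -/
theorem mem_of_le (hG : IsSpaceOfOrderings G) {γ : G →* ℤˣ}
    (hquot : IsSpaceOfOrderings (quotientStructure G γ.ker)) (hneg : γ (negOne hG) = 1)
    {T : Subgroup G} (hT : IsSaturated T) (hTγ : T ≤ γ.ker)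
    (hfull : ∀ b ∉ T, ∃ c, γ c = -1 ∧ ∀ x, (∀ t ∈ T, t.1 x = 1) → b.1 x = 1 → c.1 x = 1)
    {a b : G} (ha : γ a = 1) (hb : γ b = 1)
    (hab : ∀ x, (∀ t ∈ T, t.1 x = 1) → a.1 x = 1 → b.1 x = 1) :
    negOne hG * a ∈ T ∨ b ∈ T ∨ a * b ∈ T := by
  by_contra! h
  obtain ⟨h₁, h₂, h₃⟩ := h
  obtain ⟨s, hs, hbs⟩ := hfull b h₂
  obtain ⟨e, he, hae⟩ := hfull _ h₁
  -- Negation reverses the order: `-a ≤ e` gives the chain `-e ≤ a ≤ b ≤ s`.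
  refine h₃ (mul_mem_of_chain hG hquot hneg hT hTγ hfull (e := negOne hG * e)
    (by rw [map_mul, hneg, he]; rfl) ha hb hs ?_ hab hbs)
  intro x hx hex
  by_contra hax
  have h₄ := hae x hx (by
    rw [Subgroup.coe_mul, Pi.mul_apply, negOne_apply, units_eq_neg_one_of_ne_one hax]
    rfl)
  rw [Subgroup.coe_mul, Pi.mul_apply, negOne_apply, h₄] at hex
  exact absurd (show (-1 : ℤˣ) * 1 = 1 from hex) (by decide)

/-- In the situation of `mul_mem_of_chain`, the zero set of `T` restricts to a fan on `γ.ker`. -/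
theorem exists_eq_mul_mul (hG : IsSpaceOfOrderings G) {γ : G →* ℤˣ}
    (hquot : IsSpaceOfOrderings (quotientStructure G γ.ker)) (hneg : γ (negOne hG) = 1)
    {T : Subgroup G} (hT : IsSaturated T) (hTγ : T ≤ γ.ker)
    (hfull : ∀ b ∉ T, ∃ c, γ c = -1 ∧ ∀ x, (∀ t ∈ T, t.1 x = 1) → b.1 x = 1 → c.1 x = 1)
    {x y z : X} (hx : ∀ t ∈ T, t.1 x = 1) (hy : ∀ t ∈ T, t.1 y = 1) (hz : ∀ t ∈ T, t.1 z = 1) :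
    ∃ w : X, ∀ g, γ g = 1 → g.1 x * g.1 y * g.1 z = g.1 w := by
  obtain ⟨χ, hχ⟩ : ∃ χ : G →* ℤˣ, ∀ g, χ g = g.1 x * g.1 y * g.1 z :=
    ⟨evalChar G x * evalChar G y * evalChar G z, fun _ => rfl⟩
  have hχT : ∀ v ∈ T, χ v = 1 := fun v hv => by
    rw [hχ, hx v hv, hy v hv, hz v hv]
    rfl
  have hχn : χ (negOne hG) = -1 := by
    rw [hχ]
    rfl
  obtain ⟨w, hw⟩ := exists_eq_of_quotientStructure hG hquot hneg χ hχn (by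
    intro a ha b hb d hd hχa hχb hdab
    rw [MonoidHom.mem_ker] at ha hb hd
    -- Where `a = b`, also `d = a`; hence `ab ≤ ad`.
    rcases mem_of_le hG hquot hneg hT hTγ hfull (a := a * b) (b := a * d)
      (by rw [map_mul, ha, hb, mul_one]) (by rw [map_mul, ha, hd, mul_one]) (by
      intro v _ hv
      rw [Subgroup.coe_mul, Pi.mul_apply] at hv ⊢
      rcases hdab v with h | h
      · rw [h, Int.units_mul_self]
      · rw [h, hv]) with h | h | h
    · have h₁ := hχT _ h
      rw [map_mul, map_mul, hχa, hχb, hχn] at h₁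
      exact absurd h₁ (by decide)
    · have h₁ := hχT _ h
      rwa [map_mul, hχa, one_mul] at h₁
    · have h₁ := hχT _ h
      rwa [map_mul, map_mul, map_mul, hχa, hχb, one_mul, one_mul, one_mul] at h₁)
  exact ⟨w, fun g hg => (hχ g).symm.trans (hw g hg)⟩

/-- A character which is a product of four points on `γ.ker` and at one element outside of it. -/
theorem mem_charProducts_four {γ : G →* ℤˣ} {x y z w : X} {c : G} (hc : γ c = -1)
    (h : ∀ g, γ g = 1 → g.1 x * g.1 y * g.1 z * g.1 w = 1)
    (hcx : c.1 x * c.1 y * c.1 z * c.1 w = -1) : γ ∈ charProducts G 4 := by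
  refine ⟨![x, y, z, w], MonoidHom.ext fun g => ?_⟩
  have : (∏ i, evalChar G (![x, y, z, w] i)) g = g.1 x * g.1 y * g.1 z * g.1 w := by
    simp [Fin.prod_univ_four, evalChar]
  rw [this]
  rcases Int.units_eq_one_or (γ g) with hg | hg
  · rw [hg, h g hg]
  · have h₁ := h (g * c) (by simp [hg, hc])
    have h₂ : (g.1 x * g.1 y * g.1 z * g.1 w) * (c.1 x * c.1 y * c.1 z * c.1 w) = 1 := by
      rw [← h₁]
      simp only [Subgroup.coe_mul, Pi.mul_apply]
      ac_rfl
    rw [hcx, mul_neg_one] at h₂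
    rw [hg, ← h₂, neg_neg]

end SpaceOfOrderings

open SpaceOfOrderings in
theorem mainTheorem1 {X : Type u} (G : Subgroup (X → ℤˣ))
    (hG : SpaceOfOrderings.IsSpaceOfOrderings G)
    (G₀ : Subgroup G) (hindex : G₀.index = 2)
    (hneg : (⟨-1, hG.neg_one_mem⟩ : G) ∈ G₀)
    (γ : G →* ℤˣ) (hγ : γ.ker = G₀)
    (hquot : SpaceOfOrderings.IsSpaceOfOrderings (SpaceOfOrderings.quotientStructure G G₀)) :
    γ ∈ SpaceOfOrderings.charProducts G 4 := by
  subst hγ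
  have hneg' : γ (negOne hG) = 1 := hneg
  obtain ⟨c₀, hc₀⟩ : ∃ c, γ c = -1 := by
    by_contra! h
    have : γ.ker = ⊤ := eq_top_iff.2 fun g _ => (Int.units_eq_one_or (γ g)).resolve_right (h g)
    rw [this, Subgroup.index_top] at hindex
    omega
  have hbot : IsSaturated (⊥ : Subgroup G) := by
    intro s hs t ht c hc
    rw [Subgroup.mem_bot] at hs ht
    subst hs ht
    exact Subgroup.mem_bot.2 (Subtype.ext (funext fun x => (hc x).elim id id))
  obtain ⟨T, -, hTmax⟩ := exists_maximal_isSaturated {c | γ c = -1} ⊥ hbot (by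
    rw [Set.disjoint_left]
    intro a ha
    rw [SetLike.mem_coe, Subgroup.mem_bot] at ha
    simp [ha])
  have hT := hTmax.prop.1
  have hγT : ∀ v ∈ T, γ v = 1 := fun v hv =>
    (Int.units_eq_one_or (γ v)).resolve_right fun h => Set.disjoint_left.1 hTmax.prop.2 hv h
  have hnT : ∀ c, γ c = -1 → c ∉ T := fun c hc h => by simp [hγT c h] at hc
  have hfull : ∀ b ∉ T, ∃ c, γ c = -1 ∧
      ∀ x, (∀ t ∈ T, t.1 x = 1) → b.1 x = 1 → c.1 x = 1 := by
    intro b hb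
    by_contra! h
    -- Elements of `adjoin hG T hT b` are `1` wherever `b = 1` on the zero set of `T`.
    refine hb (hTmax.le_of_ge ⟨isSaturated_adjoin hG hT b, ?_⟩ (le_adjoin hG hT b)
      (self_mem_adjoin hG hT b))
    rw [Set.disjoint_left]
    rintro c ⟨s, hs, t, ht, hst⟩ hc
    obtain ⟨x, hx, hbx, hcx⟩ := h c hc
    have := hst x
    simp only [Subgroup.coe_mul, Pi.mul_apply, hx s hs, hx t ht, hbx, mul_one, or_self] at this
    exact hcx this
  by_cases htriv : ∀ t, γ t = 1 → t ∈ T ∨ negOne hG * t ∈ T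
  · obtain ⟨y, hy, hcy⟩ := hG.exists_separating hT (hnT c₀ hc₀)
    obtain ⟨x, hx, hcx⟩ := hG.exists_separating hT (hnT (negOne hG * c₀) (by simp [hneg', hc₀]))
    simp only [Subgroup.coe_mul, Pi.mul_apply, negOne_apply] at hcx
    -- Here `γ` is already a product of two points; `x² = 1` pads it to four.
    refine mem_charProducts_four (x := x) (y := y) (z := x) (w := x) hc₀ ?_ ?_
    · intro g hg
      rcases htriv g hg with h | h
      · simp [hx g h, hy g h]
      · have h₁ := hx _ h
        have h₂ := hy _ h
        simp only [Subgroup.coe_mul, Pi.mul_apply, negOne_apply, neg_one_mul,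
          neg_eq_iff_eq_neg] at h₁ h₂
        simp [h₁, h₂]
    · rw [neg_one_mul, neg_inj] at hcx
      simp [hcx, hcy]
  push Not at htriv
  obtain ⟨t, ht, htT, hntT⟩ := htriv
  obtain ⟨c, hc, htc⟩ := hfull t htT
  -- Since `t ≤ c`, the pairs `(t, c)` at `x, y, z` are `(1, 1)`, `(-1, -1)`, `(-1, 1)`; so `t = 1`
  -- at `w`, whence `c = 1` there.
  obtain ⟨x, hx, htx⟩ := hG.exists_separating hT hntT
  obtain ⟨y, hy, hcy⟩ := hG.exists_separating hT (hnT c hc)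
  obtain ⟨z, hz, hctz⟩ := hG.exists_separating hT (hnT (c * t) (by simp [hc, ht]))
  obtain ⟨w, hw'⟩ := exists_eq_mul_mul hG hquot hneg' hT hγT hfull hx hy hz
  refine mem_charProducts_four (x := x) (y := y) (z := z) (w := w) hc ?_ ?_
  · intro g hg
    rw [hw' g hg, Int.units_mul_self]
  · have hwT : ∀ v ∈ T, v.1 w = 1 := fun v hv => by
      rw [← hw' v (hγT v hv), hx v hv, hy v hv, hz v hv]
      rfl
    exact signs_mul_eq_neg_one _ _ _ _ _ _ _ (htc x hx) (htc y hy)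
      (fun h => htc w hwT ((hw' t ht).symm.trans h)) htx hcy (htc z hz) hctz
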